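/- Let $\mathbb C_\infty=\mathbb C\cup\{\infty\}$ be the Riemann sphere and let $\sigma$ be its spherical metric, i.e. the great-circle distance on the unit sphere after stereographic projection, so that $\mathbb C_\infty$ has diameter $\pi$. Let $D\subseteq\mathbb C_\infty$ be a domain (a non-empty connected open set), and let $\mathcal M(D)$ be the class of meromorphic functions on $D$, taking the value $\infty$ at their poles. A family $\mathcal F\subseteq\mathcal M(D)$ is called normal in $D$ if every sequence in $\mathcal F$ has a subsequence that converges locally uniformly on $D$ with respect to $\sigma$ to a limit function which is either meromorphic on $D$ or identically $\infty$. For $r>0$ let $D(z_0;r)$ be the disc $\{|z-z_0|<r\}$ if $z_0\in\mathbb C$, and $D(\infty;r)=\{z\in\mathbb C:|z|>1/r\}\cup\{\infty\}$. **Theorem 1.4.** Let $\mathcal F\subseteq\mathcal M(D)$ and $h\in\mathcal M(D)$. For $z_0\in D$ and real numbers $\epsilon_1,\epsilon_2$, let $P(z_0;\epsilon_1,\epsilon_2)$ be the assertion: there is an $r>0$ with $D(z_0;r)\subseteq D$ such that each $f\in\mathcal F$ satisfies $$\sigma(f(z),h(z))>\epsilon_1\ \text{ for all } z\in D(z_0;r)\qquad\text{or}\qquad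 \sigma(f(z),h(z))<\epsilon_2\ \text{ for all } z\in D(z_0;r).$$ 1. For all fixed $\epsilon_1,\epsilon_2$ with $0<\epsilon_1<\epsilon_2<\pi$: $\mathcal F$ is normal in $D$ if and only if $P(z_0;\epsilon_1,\epsilon_2)$ holds for every $z_0\in D$. 2. $\mathcal F$ is normal in $D$ if and only if for every $z_0\in D$ there are $\epsilon_1,\epsilon_2$ with $0<\epsilon_1<\epsilon_2<\pi$ (which may depend on $z_0$, but not on $f$) such that $P(z_0;\epsilon_1,\epsilon_2)$ holds. -/

import Mathlib

open Filter Topology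

noncomputable section

/-- The extended complex plane, with its usual topology as a one-point compactification. -/
abbrev RiemannSphere : Type := OnePoint ℂ

namespace RiemannSphere

/-- Stereographic projection of the extended plane onto the unit sphere of `ℂ × ℝ`
(with the Euclidean norm), sending `∞` to the north pole `(0, 1)`. -/
def toUnitSphere : RiemannSphere → WithLp 2 (ℂ × ℝ)
  | OnePoint.infty => WithLp.toLp 2 (0, 1)
  | OnePoint.some z =>
      WithLp.toLp 2 (2 * z / ((1 + ‖z‖ ^ 2 : ℝ) : ℂ), (‖z‖ ^ 2 - 1) / (1 + ‖z‖ ^ 2))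

/-- The spherical metric `σ`: the great-circle distance on the unit sphere between the
stereographic images, i.e. the angle between them. The sphere has diameter `π`. -/
def sphericalDist (z w : RiemannSphere) : ℝ :=
  InnerProductGeometry.angle (toUnitSphere z) (toUnitSphere w)

/-- The inversion `z ↦ 1 / z`, exchanging `0` and `∞`. -/
def inversion : RiemannSphere → RiemannSphere
  | OnePoint.infty => ((0 : ℂ) : OnePoint ℂ)
  | OnePoint.some z => if z = 0 then OnePoint.infty else ((z⁻¹ : ℂ) : OnePoint ℂ)

/-- The complex number underlying a finite point (with value `0` at `∞`). -/
def finitePart : RiemannSphere → ℂ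
  | OnePoint.infty => 0
  | OnePoint.some z => z

/-- The open disc of radius `r` about a point: the Euclidean disc `|z - a| < r` if the centre is a
finite point `a`, and the image of `|w| < r` under `z = 1 / w` if the centre is `∞`. -/
def disc : RiemannSphere → ℝ → Set RiemannSphere
  | OnePoint.infty, r => inversion '' ((fun w : ℂ => (w : OnePoint ℂ)) '' Metric.ball 0 r)
  | OnePoint.some a, r => (fun w : ℂ => (w : OnePoint ℂ)) '' Metric.ball a r

/-- A sphere-valued function `g` of a complex variable is meromorphic at `a`, poles taking the value
`∞`: near `a` it is finite except perhaps at `a`, it is meromorphic there as a complex function, and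
its value at `a` is the limiting one (the finite limit, or `∞` if `a` is a pole). -/
def IsMeromorphicAtFinite (g : ℂ → RiemannSphere) (a : ℂ) : Prop :=
  (∀ᶠ z in 𝓝[≠] a, g z ≠ OnePoint.infty) ∧
    MeromorphicAt (fun z => finitePart (g z)) a ∧ ContinuousAt g a

/-- Meromorphy at a point of the sphere, using the coordinate `1 / z` at `∞`. -/
def IsMeromorphicAt (f : RiemannSphere → RiemannSphere) : RiemannSphere → Prop
  | OnePoint.infty => IsMeromorphicAtFinite (fun w : ℂ => f (inversion (w : OnePoint ℂ))) 0
  | OnePoint.some a => IsMeromorphicAtFinite (fun z : ℂ => f (z : OnePoint ℂ)) a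

/-- The class `M(D)`: `f` is (on `D`) a meromorphic function on `D`. Values of `f` off the open set
`D` are irrelevant. -/
def IsMeromorphicOn (f : RiemannSphere → RiemannSphere) (D : Set RiemannSphere) : Prop :=
  ∀ z ∈ D, IsMeromorphicAt f z

/-- Locally uniform convergence on `D` with respect to the spherical metric. -/
def TendstoLocUnif (u : ℕ → RiemannSphere → RiemannSphere) (g : RiemannSphere → RiemannSphere)
    (D : Set RiemannSphere) : Prop :=
  ∀ ε : ℝ, 0 < ε → ∀ z ∈ D, ∃ U ∈ 𝓝[D] z, ∀ᶠ n in atTop, ∀ w ∈ U, sphericalDist (u n w) (g w) < ε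

/-- `F` is normal on `D`: each sequence in `F` has a subsequence converging spherically locally
uniformly on `D` to a function that is meromorphic on `D` or identically `∞` on `D`. -/
def IsNormalFamily (F : Set (RiemannSphere → RiemannSphere)) (D : Set RiemannSphere) : Prop :=
  ∀ u : ℕ → RiemannSphere → RiemannSphere, (∀ n, u n ∈ F) →
    ∃ k : ℕ → ℕ, StrictMono k ∧ ∃ g : RiemannSphere → RiemannSphere,
      (IsMeromorphicOn g D ∨ ∀ z ∈ D, g z = OnePoint.infty) ∧
        TendstoLocUnif (fun n => u (k n)) g D

/-- `z₀` has a disc neighbourhood in `D` on which each `f ∈ F` stays spherically farther than `ε₁`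
from `h` throughout, or stays spherically closer than `ε₂` to `h` throughout. -/
def FarOrNearAt (F : Set (RiemannSphere → RiemannSphere)) (h : RiemannSphere → RiemannSphere)
    (D : Set RiemannSphere) (ε₁ ε₂ : ℝ) (z₀ : RiemannSphere) : Prop :=
  ∃ r : ℝ, 0 < r ∧ disc z₀ r ⊆ D ∧ ∀ f ∈ F,
    (∀ z ∈ disc z₀ r, ε₁ < sphericalDist (f z) (h z)) ∨
      (∀ z ∈ disc z₀ r, sphericalDist (f z) (h z) < ε₂)

end RiemannSphere

end

noncomputable section

namespace RiemannSphere

/-! Far-or-near implies normal. Near `z₀` the continuous function `h` is almost the constant `h z₀`,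
so a member far from `h` omits a fixed neighbourhood of `h z₀`, and a member near `h` omits a fixed
neighbourhood of the antipode of `h z₀` (`FarOrNearAt.exists_isClosed`). A Möbius coordinate with
its pole at the omitted point turns such functions into uniformly bounded holomorphic ones. The
Schwarz lemma then gives equicontinuity (`exists_ball_forall_mem_uniformity`), and Arzelà–Ascoli a
locally uniformly convergent subsequence. On a small disc infinitely many of its terms avoid the
same point, so by Weierstrass the limit is holomorphic in that coordinate, hence meromorphic or `∞`
near each point; connectedness of `D` makes the alternative global (`isNormalFamily_of_mapsTo`).

Normal implies far-or-near, for every pair `ε₁ < ε₂`. Otherwise some sequence in the family has, at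
points tending to `z₀`, distances to `h` that are at most `ε₁` and also at least `ε₂`; along a
convergent subsequence both have the same limit (`IsNormalFamily.farOrNearAt`). -/

/-! ### The spherical metric and stereographic projection. -/

theorem toUnitSphere_infty : toUnitSphere OnePoint.infty = WithLp.toLp 2 (0, 1) := rfl

theorem toUnitSphere_coe (z : ℂ) : toUnitSphere (z : OnePoint ℂ) =
    WithLp.toLp 2 (2 * z / ((1 + ‖z‖ ^ 2 : ℝ) : ℂ), (‖z‖ ^ 2 - 1) / (1 + ‖z‖ ^ 2)) := rfl

theorem norm_toUnitSphere (z : RiemannSphere) : ‖toUnitSphere z‖ = 1 := by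
  have key : ‖toUnitSphere z‖ ^ 2 = 1 := by
    induction z using OnePoint.rec with
    | infty => simp [toUnitSphere_infty]
    | coe z =>
      have h : (0 : ℝ) < 1 + ‖z‖ ^ 2 := by positivity
      rw [toUnitSphere_coe, WithLp.prod_norm_sq_eq_of_L2]
      change ‖2 * z / ((1 + ‖z‖ ^ 2 : ℝ) : ℂ)‖ ^ 2 + ‖(‖z‖ ^ 2 - 1) / (1 + ‖z‖ ^ 2)‖ ^ 2 = 1
      simp only [norm_div, norm_mul, Complex.norm_real, Real.norm_eq_abs, abs_of_pos h,
        Complex.norm_ofNat, div_pow, sq_abs]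
      field_simp
      ring
  have h0 : (0 : ℝ) ≤ ‖toUnitSphere z‖ := norm_nonneg _
  nlinarith

theorem toUnitSphere_ne_zero (z : RiemannSphere) : toUnitSphere z ≠ 0 := by
  rw [← norm_ne_zero_iff, norm_toUnitSphere]
  exact one_ne_zero

/-- The height `1 - 2 / (1 + ‖z‖ ^ 2)` is below `1`, the height of the pole, and determines `‖z‖`;
the horizontal component then determines `z`. -/
theorem toUnitSphere_injective : Function.Injective toUnitSphere := by
  have height (z : ℂ) : (‖z‖ ^ 2 - 1) / (1 + ‖z‖ ^ 2) = 1 - 2 / (1 + ‖z‖ ^ 2) := by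
    field_simp
    ring
  have height_lt (z : ℂ) : (‖z‖ ^ 2 - 1) / (1 + ‖z‖ ^ 2) < 1 := by
    rw [height]
    have : (0 : ℝ) < 2 / (1 + ‖z‖ ^ 2) := by positivity
    linarith
  intro a b hab
  induction a using OnePoint.rec with
  | infty =>
    induction b using OnePoint.rec with
    | infty => rfl
    | coe w =>
      have := congrArg (fun p => p.snd) hab
      simp only [toUnitSphere_infty, toUnitSphere_coe] at this
      exact absurd this.symm (height_lt w).ne
  | coe z =>
    induction b using OnePoint.rec with
    | infty =>
      have := congrArg (fun p => p.snd) hab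
      simp only [toUnitSphere_infty, toUnitSphere_coe] at this
      exact absurd this (height_lt z).ne
    | coe w =>
      have h2 := congrArg (fun p => p.snd) hab
      have h1 := congrArg (fun p => p.fst) hab
      change (‖z‖ ^ 2 - 1) / (1 + ‖z‖ ^ 2) = (‖w‖ ^ 2 - 1) / (1 + ‖w‖ ^ 2) at h2
      change 2 * z / ((1 + ‖z‖ ^ 2 : ℝ) : ℂ) = 2 * w / ((1 + ‖w‖ ^ 2 : ℝ) : ℂ) at h1
      have hz : (0 : ℝ) < 1 + ‖z‖ ^ 2 := by positivity
      have hw : (0 : ℝ) < 1 + ‖w‖ ^ 2 := by positivity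
      have h3 : 1 + ‖z‖ ^ 2 = 1 + ‖w‖ ^ 2 := by
        rw [div_eq_div_iff hz.ne' hw.ne'] at h2
        linarith
      rw [h3, div_left_inj' (Complex.ofReal_ne_zero.2 hw.ne')] at h1
      rw [mul_left_cancel₀ two_ne_zero h1]

theorem continuous_toUnitSphere : Continuous toUnitSphere := by
  rw [OnePoint.continuous_iff]
  refine ⟨?_, ?_⟩
  · rw [Filter.coclosedCompact_eq_cocompact, ← Metric.cobounded_eq_cocompact]
    simp only [toUnitSphere_infty, toUnitSphere_coe]
    refine (WithLp.prod_continuous_toLp 2 ℂ ℝ).continuousAt.tendsto.comp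
      (Tendsto.prodMk_nhds ?_ ?_)
    · rw [tendsto_zero_iff_norm_tendsto_zero]
      have h1 : Tendsto (fun z : ℂ => 2 * ‖z‖⁻¹) (Bornology.cobounded ℂ) (𝓝 0) := by
        simpa using (tendsto_inv_atTop_zero.comp tendsto_norm_cobounded_atTop).const_mul (2 : ℝ)
      refine squeeze_zero (fun _ => norm_nonneg _) (fun z => ?_) h1
      have h : (0 : ℝ) < 1 + ‖z‖ ^ 2 := by positivity
      simp only [norm_div, norm_mul, Complex.norm_real, Real.norm_eq_abs, abs_of_pos h,
        Complex.norm_ofNat]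
      rcases eq_or_ne z 0 with rfl | hz
      · simp
      · have hz' := norm_pos_iff.2 hz
        rw [← div_eq_mul_inv, div_le_div_iff₀ h hz']
        nlinarith
    · have h1 : Tendsto (fun z : ℂ => 1 - 2 / (1 + ‖z‖ ^ 2)) (Bornology.cobounded ℂ)
          (𝓝 (1 - 0)) := by
        refine tendsto_const_nhds.sub (Tendsto.div_atTop tendsto_const_nhds ?_)
        exact tendsto_atTop_add_const_left _ _
          ((tendsto_pow_atTop two_ne_zero).comp tendsto_norm_cobounded_atTop)
      rw [sub_zero] at h1
      refine h1.congr fun z => ?_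
      field_simp
      ring
  · simp only [toUnitSphere_coe]
    refine (WithLp.prod_continuous_toLp 2 ℂ ℝ).comp (Continuous.prodMk ?_ ?_)
    · refine Continuous.div (by fun_prop) (by fun_prop) fun z => ?_
      exact Complex.ofReal_ne_zero.2 (by positivity)
    · exact Continuous.div (by fun_prop) (by fun_prop) fun z => by positivity

theorem continuous_sphericalDist :
    Continuous fun p : RiemannSphere × RiemannSphere => sphericalDist p.1 p.2 := by
  rw [continuous_iff_continuousAt]
  intro p
  exact ContinuousAt.comp (f := fun p : RiemannSphere × RiemannSphere =>
      (toUnitSphere p.1, toUnitSphere p.2))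
    (InnerProductGeometry.continuousAt_angle (toUnitSphere_ne_zero p.1) (toUnitSphere_ne_zero p.2))
    ((continuous_toUnitSphere.comp continuous_fst).prodMk
      (continuous_toUnitSphere.comp continuous_snd)).continuousAt

theorem sphericalDist_self (z : RiemannSphere) : sphericalDist z z = 0 :=
  InnerProductGeometry.angle_self (toUnitSphere_ne_zero z)

theorem sphericalDist_comm (z w : RiemannSphere) : sphericalDist z w = sphericalDist w z :=
  InnerProductGeometry.angle_comm _ _

theorem sphericalDist_nonneg (z w : RiemannSphere) : 0 ≤ sphericalDist z w :=
  InnerProductGeometry.angle_nonneg _ _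

theorem sphericalDist_triangle (x y z : RiemannSphere) :
    sphericalDist x z ≤ sphericalDist x y + sphericalDist y z :=
  InnerProductGeometry.angle_le_angle_add_angle _ _ _

theorem sphericalDist_pos {z w : RiemannSphere} (hzw : z ≠ w) : 0 < sphericalDist z w := by
  refine (sphericalDist_nonneg z w).lt_of_ne fun h0 => hzw (toUnitSphere_injective ?_)
  have h1 := (InnerProductGeometry.inner_eq_mul_norm_iff_angle_eq_zero
    (toUnitSphere_ne_zero z) (toUnitSphere_ne_zero w)).2 h0.symm
  rw [norm_toUnitSphere, norm_toUnitSphere, one_mul] at h1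
  exact (inner_eq_one_iff_of_norm_eq_one (norm_toUnitSphere z) (norm_toUnitSphere w)).1 h1

/-- Each point of the sphere has an antipode. -/
theorem exists_sphericalDist_eq_pi (a : RiemannSphere) : ∃ b, sphericalDist b a = Real.pi := by
  suffices H : ∃ b, toUnitSphere b = -toUnitSphere a by
    obtain ⟨b, hb⟩ := H
    exact ⟨b, by rw [sphericalDist, hb,
      InnerProductGeometry.angle_neg_self_of_nonzero (toUnitSphere_ne_zero a)]⟩
  induction a using OnePoint.rec with
  | infty =>
    refine ⟨((0 : ℂ) : OnePoint ℂ), ?_⟩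
    rw [toUnitSphere_infty, toUnitSphere_coe, ← WithLp.toLp_neg]
    simp
  | coe z =>
    rcases eq_or_ne z 0 with rfl | hz
    · refine ⟨OnePoint.infty, ?_⟩
      rw [toUnitSphere_infty, toUnitSphere_coe, ← WithLp.toLp_neg]
      simp
    -- The antipode of `z` is minus the inverse of its conjugate, here written `-z / ‖z‖ ^ 2`.
    · refine ⟨((-z / ((‖z‖ ^ 2 : ℝ) : ℂ) : ℂ) : OnePoint ℂ), ?_⟩
      have hz' := norm_pos_iff.2 hz
      have hn : ‖-z / ((‖z‖ ^ 2 : ℝ) : ℂ)‖ = ‖z‖⁻¹ := by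
        rw [norm_div, norm_neg, Complex.norm_real, Real.norm_eq_abs, abs_of_pos (by positivity)]
        field_simp
      have hne : (‖z‖ : ℂ) ≠ 0 := Complex.ofReal_ne_zero.2 hz'.ne'
      have hne' : (1 + (‖z‖ : ℂ) ^ 2) ≠ 0 := by
        exact_mod_cast (by positivity : (1 + ‖z‖ ^ 2 : ℝ) ≠ 0)
      have hne2 : ((‖z‖ : ℂ) ^ 2 + 1) ≠ 0 := by rwa [add_comm]
      rw [toUnitSphere_coe, toUnitSphere_coe, hn, ← WithLp.toLp_neg, Prod.neg_mk]
      congr 2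
      · push_cast
        field_simp
        ring
      · field_simp
        ring

/-! ### Countability and the uniformity of the sphere. -/

/-- Passes to the space of continuous maps from `D` to the sphere, so that compact sets there are
sequentially compact. -/
instance : SecondCountableTopology RiemannSphere :=
  (continuous_toUnitSphere.isClosedEmbedding
    toUnitSphere_injective).isEmbedding.secondCountableTopology

/-- A compact Hausdorff space has exactly one compatible uniformity. The topology field is given
explicitly so that it is the existing topology by definition. -/
instance : UniformSpace RiemannSphere where
  toTopologicalSpace := OnePoint.instTopologicalSpace
  uniformity := (uniformSpaceOfCompactR1 (γ := RiemannSphere)).uniformity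
  symm := uniformSpaceOfCompactR1.symm
  comp := uniformSpaceOfCompactR1.comp
  nhds_eq_comap_uniformity := uniformSpaceOfCompactR1.nhds_eq_comap_uniformity

/-- The spherical metric induces the uniform structure of the sphere. -/
theorem hasBasis_uniformity_sphericalDist :
    (uniformity RiemannSphere).HasBasis (fun ε : ℝ => 0 < ε)
      fun ε => {p | sphericalDist p.1 p.2 < ε} := by
  refine ⟨fun V => ⟨fun hV => ?_, ?_⟩⟩
  -- This compact set misses the diagonal, so the distance has a positive minimum on it, which
  -- serves as `ε`.
  · have hc : IsCompact (interior V)ᶜ := isOpen_interior.isClosed_compl.isCompact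
    rcases (interior V)ᶜ.eq_empty_or_nonempty with he | hne
    · refine ⟨1, one_pos, fun p _ => interior_subset ?_⟩
      rw [Set.compl_empty_iff] at he
      rw [he]
      trivial
    · obtain ⟨p, hp, hmin⟩ := hc.exists_isMinOn hne continuous_sphericalDist.continuousOn
      refine ⟨sphericalDist p.1 p.2, sphericalDist_pos fun hd => hp ?_, fun q hq => ?_⟩
      · rw [mem_interior_iff_mem_nhds]
        have h2 := mem_nhdsSet_iff_forall.1 (nhdsSet_diagonal_eq_uniformity.ge hV) p hd
        exact h2
      · by_contra hqV
        have hle : sphericalDist p.1 p.2 ≤ sphericalDist q.1 q.2 :=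
          hmin fun h => hqV (interior_subset h)
        exact absurd hle (not_le.2 hq)
  · rintro ⟨ε, hε, hV⟩
    refine mem_of_superset ?_ hV
    rw [← nhdsSet_diagonal_eq_uniformity]
    refine (isOpen_lt continuous_sphericalDist continuous_const).mem_nhdsSet.2 ?_
    rintro ⟨x, y⟩ hxy
    obtain rfl : x = y := hxy
    change sphericalDist x x < ε
    rwa [sphericalDist_self]

theorem tendstoLocUnif_iff {u : ℕ → RiemannSphere → RiemannSphere}
    {g : RiemannSphere → RiemannSphere} {D : Set RiemannSphere} :
    TendstoLocUnif u g D ↔ TendstoLocallyUniformlyOn u g atTop D := by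
  constructor
  · intro H V hV z hz
    obtain ⟨ε, hε, hεV⟩ := hasBasis_uniformity_sphericalDist.mem_iff.1 hV
    obtain ⟨U, hU, hn⟩ := H ε hε z hz
    refine ⟨U, hU, hn.mono fun n hn w hw => hεV ?_⟩
    exact (sphericalDist_comm _ _).trans_lt (hn w hw)
  · intro H ε hε z hz
    obtain ⟨U, hU, hn⟩ := H _ (hasBasis_uniformity_sphericalDist.mem_of_mem hε) z hz
    refine ⟨U, hU, hn.mono fun n hn w hw => ?_⟩
    rw [sphericalDist_comm]
    exact hn w hw

/-! ### Möbius coordinates with a prescribed pole. -/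

theorem tendsto_coe_cobounded :
    Tendsto (fun z : ℂ => (z : OnePoint ℂ)) (Bornology.cobounded ℂ) (𝓝 OnePoint.infty) := by
  rw [Metric.cobounded_eq_cocompact, ← Filter.coclosedCompact_eq_cocompact]
  exact OnePoint.tendsto_coe_infty

/-- A Möbius coordinate on the sphere with pole `a`. -/
def coordAway : RiemannSphere → RiemannSphere → ℂ
  | OnePoint.infty, z => finitePart z
  -- The value `0` at `∞` is the true limit, whereas at `z = a` it is only the convention `0⁻¹ = 0`;
  -- hence the condition `z ≠ a` in the lemmas below.
  | OnePoint.some a, z => OnePoint.elim z 0 fun z => (z - a)⁻¹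

/-- The inverse of the Möbius coordinate with pole `a`. -/
def coordAwaySymm : RiemannSphere → ℂ → RiemannSphere
  | OnePoint.infty, w => (w : OnePoint ℂ)
  | OnePoint.some a, w => if w = 0 then OnePoint.infty else ((a + w⁻¹ : ℂ) : OnePoint ℂ)

theorem coordAway_coe_coe (a z : ℂ) :
    coordAway (a : OnePoint ℂ) (z : OnePoint ℂ) = (z - a)⁻¹ := rfl

theorem coordAway_coe_infty (a : ℂ) : coordAway (a : OnePoint ℂ) OnePoint.infty = 0 := rfl

theorem coordAwaySymm_coe (a w : ℂ) : coordAwaySymm (a : OnePoint ℂ) w =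
    if w = 0 then OnePoint.infty else ((a + w⁻¹ : ℂ) : OnePoint ℂ) := rfl

theorem continuous_coordAwaySymm (a : RiemannSphere) : Continuous (coordAwaySymm a) := by
  induction a using OnePoint.rec with
  | infty => exact OnePoint.continuous_coe
  | coe a =>
    rw [continuous_iff_continuousAt]
    intro w
    rcases eq_or_ne w 0 with rfl | hw
    · rw [← continuousWithinAt_compl_self, ContinuousWithinAt, coordAwaySymm_coe, if_pos rfl]
      have h1 : Tendsto (fun w : ℂ => ((a + w⁻¹ : ℂ) : OnePoint ℂ)) (𝓝[≠] 0)
          (𝓝 OnePoint.infty) :=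
        tendsto_coe_cobounded.comp
          ((tendsto_const_add_cobounded a).comp tendsto_inv₀_nhdsNE_zero)
      refine h1.congr' ?_
      filter_upwards [self_mem_nhdsWithin] with v hv
      exact (if_neg hv).symm
    · have h1 : ContinuousAt (fun w : ℂ => ((a + w⁻¹ : ℂ) : OnePoint ℂ)) w :=
        OnePoint.continuous_coe.continuousAt.comp
          (continuousAt_const.add (continuousAt_inv₀ hw))
      refine h1.congr ?_
      filter_upwards [isOpen_ne.mem_nhds hw] with v hv
      rw [coordAwaySymm_coe, if_neg hv]

theorem continuousAt_coordAway {a z : RiemannSphere} (hz : z ≠ a) :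
    ContinuousAt (coordAway a) z := by
  induction a using OnePoint.rec with
  | infty =>
    induction z using OnePoint.rec with
    | infty => exact absurd rfl hz
    | coe z => exact OnePoint.continuousAt_coe.2 continuousAt_id
  | coe a =>
    induction z using OnePoint.rec with
    | infty =>
      rw [OnePoint.continuousAt_infty', Filter.coclosedCompact_eq_cocompact,
        ← Metric.cobounded_eq_cocompact]
      exact tendsto_inv₀_cobounded.comp (tendsto_sub_const_cobounded a)
    | coe z =>
      refine OnePoint.continuousAt_coe.2 ?_
      have hne : z - a ≠ 0 := sub_ne_zero.2 fun h => hz (congrArg _ h)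
      exact (continuousAt_id.sub continuousAt_const).inv₀ hne

theorem coordAwaySymm_coordAway {a z : RiemannSphere} (hz : z ≠ a) :
    coordAwaySymm a (coordAway a z) = z := by
  induction a using OnePoint.rec with
  | infty =>
    induction z using OnePoint.rec with
    | infty => exact absurd rfl hz
    | coe z => rfl
  | coe a =>
    induction z using OnePoint.rec with
    | infty => rw [coordAway_coe_infty, coordAwaySymm_coe, if_pos rfl]
    | coe z =>
      have hne : z - a ≠ 0 := sub_ne_zero.2 fun h => hz (congrArg _ h)
      rw [coordAway_coe_coe, coordAwaySymm_coe, if_neg (inv_ne_zero hne), inv_inv,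
        add_sub_cancel]

theorem coe_finitePart {z : RiemannSphere} (hz : z ≠ OnePoint.infty) :
    ((finitePart z : ℂ) : OnePoint ℂ) = z :=
  coordAwaySymm_coordAway hz

/-- A meromorphic function is holomorphic in a Möbius coordinate whose pole it avoids. -/
theorem IsMeromorphicAtFinite.differentiableAt_coordAway {k : ℂ → RiemannSphere} {w : ℂ}
    (hk : IsMeromorphicAtFinite k w) {a : RiemannSphere} (ha : k w ≠ a) :
    DifferentiableAt ℂ (fun v => coordAway a (k v)) w := by
  obtain ⟨hfin, hmer, hcont⟩ := hk
  -- Removable singularity: a pole of `k` at `w` is harmless, because the coordinate is continuous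
  -- at `k w`.
  refine (Complex.analyticAt_of_differentiable_on_punctured_nhds_of_continuousAt ?_
    (ContinuousAt.comp (g := coordAway a) (continuousAt_coordAway ha) hcont)).differentiableAt
  have hne : ∀ᶠ v in 𝓝[≠] w, k v ≠ a :=
    (hcont.eventually_ne ha).filter_mono nhdsWithin_le_nhds
  filter_upwards [hmer.eventually_analyticAt, hne, eventually_eventually_nhdsWithin.2 hfin,
    self_mem_nhdsWithin] with v hv hva hvfin hvw
  replace hvfin : ∀ᶠ x in 𝓝 v, k x ≠ OnePoint.infty := by
    rwa [nhdsWithin_eq_nhds.2 (isOpen_compl_singleton.mem_nhds hvw)] at hvfin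
  induction a using OnePoint.rec with
  | infty => exact hv.differentiableAt
  | coe a =>
    have hsub : finitePart (k v) - a ≠ 0 := by
      refine sub_ne_zero.2 fun h => hva ?_
      rw [← coe_finitePart hvfin.self_of_nhds, h]
    refine ((hv.differentiableAt.sub_const a).inv hsub).congr_of_eventuallyEq ?_
    filter_upwards [hvfin] with x hx
    change coordAway (a : OnePoint ℂ) (k x) = (finitePart (k x) - a)⁻¹
    rw [← coordAway_coe_coe, coe_finitePart hx]

/-- The image of a holomorphic function under a Möbius map is meromorphic or constantly `∞`. -/
theorem isMeromorphicAtFinite_coordAwaySymm {G : ℂ → ℂ} {w : ℂ} (hG : AnalyticAt ℂ G w)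
    (a : RiemannSphere) :
    IsMeromorphicAtFinite (fun v => coordAwaySymm a (G v)) w ∨
      ∀ᶠ v in 𝓝 w, coordAwaySymm a (G v) = OnePoint.infty := by
  have hcont : ContinuousAt (fun v => coordAwaySymm a (G v)) w :=
    (continuous_coordAwaySymm a).continuousAt.comp hG.continuousAt
  induction a using OnePoint.rec with
  | infty =>
    exact Or.inl ⟨Eventually.of_forall fun v => OnePoint.coe_ne_infty _, hG.meromorphicAt, hcont⟩
  | coe a =>
    -- Zeros of `G` correspond to the value `∞`: either `G` vanishes near `w`, or its zeros are
    -- isolated and become poles.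
    rcases hG.eventually_eq_zero_or_eventually_ne_zero with h0 | h0
    · right
      filter_upwards [h0] with v hv
      rw [hv, coordAwaySymm_coe, if_pos rfl]
    · left
      refine ⟨?_, ?_, hcont⟩
      · filter_upwards [h0] with v hv
        rw [coordAwaySymm_coe, if_neg hv]
        exact OnePoint.coe_ne_infty _
      · have hm : MeromorphicAt (fun v => a + (G v)⁻¹) w :=
          (MeromorphicAt.const a w).add hG.meromorphicAt.inv
        refine hm.congr ?_
        filter_upwards [h0] with v hv
        rw [coordAwaySymm_coe, if_neg hv]
        rfl

/-! ### Inversion, charts and discs. -/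

theorem inversion_coe (z : ℂ) :
    inversion (z : OnePoint ℂ) = if z = 0 then OnePoint.infty else ((z⁻¹ : ℂ) : OnePoint ℂ) := rfl

theorem inversion_infty : inversion OnePoint.infty = ((0 : ℂ) : OnePoint ℂ) := rfl

theorem inversion_inversion (z : RiemannSphere) : inversion (inversion z) = z := by
  induction z using OnePoint.rec with
  | infty => rw [inversion_infty, inversion_coe, if_pos rfl]
  | coe z =>
    rcases eq_or_ne z 0 with rfl | hz
    · rw [inversion_coe, if_pos rfl, inversion_infty]
    · rw [inversion_coe, if_neg hz, inversion_coe, if_neg (inv_ne_zero hz), inv_inv]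

theorem inversion_coe_eq_coordAwaySymm (z : ℂ) :
    inversion (z : OnePoint ℂ) = coordAwaySymm ((0 : ℂ) : OnePoint ℂ) z := by
  rw [inversion_coe, coordAwaySymm_coe, zero_add]

theorem continuous_inversion : Continuous inversion := by
  rw [OnePoint.continuous_iff]
  refine ⟨?_, ?_⟩
  · rw [Filter.coclosedCompact_eq_cocompact, ← Metric.cobounded_eq_cocompact, inversion_infty]
    have h1 : Tendsto (fun z : ℂ => ((z⁻¹ : ℂ) : OnePoint ℂ)) (Bornology.cobounded ℂ)
        (𝓝 ((0 : ℂ) : OnePoint ℂ)) :=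
      OnePoint.continuous_coe.continuousAt.tendsto.comp tendsto_inv₀_cobounded
    refine h1.congr' ?_
    filter_upwards [Bornology.eventually_ne_cobounded (0 : ℂ)] with z hz
    rw [inversion_coe, if_neg hz]
  · simp only [inversion_coe_eq_coordAwaySymm]
    exact continuous_coordAwaySymm _

/-- The inversion as a self-homeomorphism of the sphere. -/
def inversionHomeomorph : RiemannSphere ≃ₜ RiemannSphere where
  toFun := inversion
  invFun := inversion
  left_inv := inversion_inversion
  right_inv := inversion_inversion
  continuous_toFun := continuous_inversion
  continuous_invFun := continuous_inversion

/-- The holomorphic parametrization of a neighbourhood of a point: the identity about a finite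
point, and `w ↦ 1 / w` about `∞`. -/
def chart : RiemannSphere → ℂ → RiemannSphere
  | OnePoint.infty, w => inversion (w : OnePoint ℂ)
  | OnePoint.some _, w => (w : OnePoint ℂ)

/-- The parameter of the point `z₀` in the parametrization `chart z₀`. -/
def chartCenter : RiemannSphere → ℂ
  | OnePoint.infty => 0
  | OnePoint.some a => a

theorem isOpenEmbedding_chart (z₀ : RiemannSphere) : IsOpenEmbedding (chart z₀) := by
  induction z₀ using OnePoint.rec with
  | infty => exact inversionHomeomorph.isOpenEmbedding.comp OnePoint.isOpenEmbedding_coe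
  | coe a => exact OnePoint.isOpenEmbedding_coe

theorem chart_chartCenter (z₀ : RiemannSphere) : chart z₀ (chartCenter z₀) = z₀ := by
  induction z₀ using OnePoint.rec with
  | infty => exact if_pos rfl
  | coe a => rfl

theorem disc_eq_image_chart (z₀ : RiemannSphere) (r : ℝ) :
    disc z₀ r = chart z₀ '' Metric.ball (chartCenter z₀) r := by
  induction z₀ using OnePoint.rec with
  | infty => exact Set.image_image _ _ _
  | coe a => rfl

theorem hasBasis_nhds_disc (z₀ : RiemannSphere) :
    (𝓝 z₀).HasBasis (fun r : ℝ => 0 < r) (disc z₀) := by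
  have h := (Metric.nhds_basis_ball (x := chartCenter z₀)).map (chart z₀)
  rw [(isOpenEmbedding_chart z₀).map_nhds_eq, chart_chartCenter] at h
  simpa only [← disc_eq_image_chart] using h

theorem disc_subset_disc (z₀ : RiemannSphere) {r s : ℝ} (h : r ≤ s) : disc z₀ r ⊆ disc z₀ s := by
  rw [disc_eq_image_chart, disc_eq_image_chart]
  exact Set.image_mono (Metric.ball_subset_ball h)

theorem isMeromorphicAt_iff {f : RiemannSphere → RiemannSphere} {z₀ : RiemannSphere} :
    IsMeromorphicAt f z₀ ↔
      IsMeromorphicAtFinite (fun w => f (chart z₀ w)) (chartCenter z₀) := by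
  induction z₀ using OnePoint.rec with
  | infty => rfl
  | coe a => rfl

theorem IsMeromorphicAt.continuousAt {f : RiemannSphere → RiemannSphere} {z₀ : RiemannSphere}
    (hf : IsMeromorphicAt f z₀) : ContinuousAt f z₀ := by
  have h := (isMeromorphicAt_iff.1 hf).2.2
  rw [← chart_chartCenter z₀]
  exact (isOpenEmbedding_chart z₀).continuousAt_iff.1 h

/-- Meromorphy at a point implies meromorphy in each coordinate about that point. -/
theorem IsMeromorphicAt.comp_chart {f : RiemannSphere → RiemannSphere} {z₀ : RiemannSphere}
    {w : ℂ} (hf : IsMeromorphicAt f (chart z₀ w)) :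
    IsMeromorphicAtFinite (fun v => f (chart z₀ v)) w := by
  induction z₀ using OnePoint.rec with
  | coe a => exact hf
  | infty =>
    rcases eq_or_ne w 0 with rfl | hw
    · rw [show chart OnePoint.infty 0 = OnePoint.infty from chart_chartCenter _] at hf
      exact hf
    -- For a nonzero parameter the point is finite, so meromorphy is known in the identity chart and
    -- is carried over by `v ↦ v⁻¹`, analytic near `w`.
    · have hcont : ContinuousAt (fun v => f (chart OnePoint.infty v)) w :=
        ContinuousAt.comp (g := f) hf.continuousAt
          (isOpenEmbedding_chart OnePoint.infty).continuous.continuousAt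
      have hchart {v : ℂ} (hv : v ≠ 0) :
          chart OnePoint.infty v = ((v⁻¹ : ℂ) : OnePoint ℂ) := if_neg hv
      rw [hchart hw] at hf
      obtain ⟨hfin, hmer, -⟩ := hf
      have hne : ∀ᶠ v in 𝓝[≠] w, v ≠ 0 :=
        (eventually_ne_nhds hw).filter_mono nhdsWithin_le_nhds
      refine ⟨?_, ?_, hcont⟩
      · have ht : Tendsto (fun v : ℂ => v⁻¹) (𝓝[≠] w) (𝓝[≠] w⁻¹) :=
          (continuousAt_inv₀ hw).continuousWithinAt.tendsto_nhdsWithin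
            fun v hv h => hv (inv_injective h)
        filter_upwards [ht.eventually hfin, hne] with v hv hv0
        rwa [hchart hv0]
      · have hm := hmer.comp_analyticAt (g := fun v : ℂ => v⁻¹) (analyticAt_inv hw)
        refine hm.congr ?_
        filter_upwards [hne] with v hv0
        rw [hchart hv0]
        rfl

/-! ### Compactness, and functions omitting a neighbourhood of a point. -/

/-- A form of the **Arzelà–Ascoli theorem**: an equicontinuous set of maps into a compact Hausdorff
uniform space is contained in a compact set of maps. -/
theorem exists_isCompact_superset_of_equicontinuous {X Y : Type*} [TopologicalSpace X]
    [UniformSpace Y] [CompactSpace Y] (S : Set C(X, Y))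
    (hS : (ContinuousMap.toFun '' S).Equicontinuous) : ∃ S', IsCompact S' ∧ S ⊆ S' := by
  have hcl := hS.closure
  -- The pointwise closure is still equicontinuous, so it consists of continuous maps; being closed
  -- in a product of compact spaces, it is compact.
  have himage : ContinuousMap.toFun '' {φ : C(X, Y) | φ.toFun ∈ closure (ContinuousMap.toFun '' S)}
      = closure (ContinuousMap.toFun '' S) := by
    refine Set.Subset.antisymm (Set.image_subset_iff.2 fun _ h => h) fun f hf => ?_
    exact ⟨⟨f, hcl.continuous ⟨f, hf⟩⟩, hf, rfl⟩
  refine ⟨{φ | φ.toFun ∈ closure (ContinuousMap.toFun '' S)},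
    ArzelaAscoli.isCompact_of_equicontinuous _ ?_ ?_, fun φ hφ =>
      subset_closure (Set.mem_image_of_mem _ hφ)⟩
  · rw [himage]
    exact isClosed_closure.isCompact
  · exact hcl.comp fun φ : {φ : C(X, Y) | φ.toFun ∈ closure (ContinuousMap.toFun '' S)} =>
      (⟨φ.1.toFun, φ.2⟩ : closure (ContinuousMap.toFun '' S))

theorem IsMeromorphicAtFinite.congr {k l : ℂ → RiemannSphere} {w : ℂ}
    (hk : IsMeromorphicAtFinite k w) (h : k =ᶠ[𝓝 w] l) : IsMeromorphicAtFinite l w := by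
  obtain ⟨hfin, hmer, hcont⟩ := hk
  have h' : k =ᶠ[𝓝[≠] w] l := h.filter_mono nhdsWithin_le_nhds
  refine ⟨?_, hmer.congr ?_, hcont.congr h⟩
  · filter_upwards [hfin, h'] with v hv hvl
    rwa [← hvl]
  · filter_upwards [h'] with v hvl
    rw [hvl]

theorem continuousOn_coordAway {K : Set RiemannSphere} {a : RiemannSphere} (ha : a ∉ K) :
    ContinuousOn (coordAway a) K := fun _ hz =>
  (continuousAt_coordAway (ne_of_mem_of_not_mem hz ha)).continuousWithinAt

/-- Meromorphic functions on a disc with values in a fixed closed proper subset of the sphere are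
equicontinuous at the centre. -/
theorem exists_ball_forall_mem_uniformity {K : Set RiemannSphere} (hK : IsClosed K)
    {a : RiemannSphere} (ha : a ∉ K) (c : ℂ) {r : ℝ} (hr : 0 < r)
    {V : Set (RiemannSphere × RiemannSphere)} (hV : V ∈ uniformity RiemannSphere) :
    ∃ s, 0 < s ∧ ∀ k : ℂ → RiemannSphere, (∀ w ∈ Metric.ball c r, IsMeromorphicAtFinite k w) →
      (∀ w ∈ Metric.ball c r, k w ∈ K) → ∀ w ∈ Metric.ball c s, (k c, k w) ∈ V := by
  obtain ⟨M, hM⟩ := (hK.isCompact.image_of_continuousOn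
    (continuousOn_coordAway ha)).isBounded.subset_closedBall (0 : ℂ)
  have huc : UniformContinuousOn (coordAwaySymm a) (Metric.closedBall 0 M) :=
    (isCompact_closedBall 0 M).uniformContinuousOn_of_continuous
      (continuous_coordAwaySymm a).continuousOn
  obtain ⟨δ, hδ, hδV⟩ :=
    (Metric.uniformity_basis_dist.inf_principal _).mem_iff.1 (Filter.mem_map.1 (huc hV))
  -- In the coordinate the disc of radius `r` maps within `2 * |M|` of the image of its centre, so
  -- the Schwarz lemma gives the Lipschitz bound `2 * |M| / r`. The `+ 1` keeps the denominator
  -- positive, and `|M|` is used since `M` may be negative when `K` is empty.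
  refine ⟨min r (δ * r / (2 * |M| + 1)), lt_min hr (by positivity), fun k hk hkK w hw => ?_⟩
  obtain ⟨hwr, hws⟩ := lt_min_iff.1 (Metric.mem_ball.1 hw)
  have hmem {v : ℂ} (hv : v ∈ Metric.ball c r) :
      coordAway a (k v) ∈ Metric.closedBall 0 M := hM ⟨k v, hkK v hv, rfl⟩
  have hc : c ∈ Metric.ball c r := Metric.mem_ball_self hr
  have hdist : dist (coordAway a (k w)) (coordAway a (k c)) ≤ 2 * |M| / r * dist w c := by
    refine Complex.dist_le_div_mul_dist_of_mapsTo_ball (f := fun v => coordAway a (k v))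
      (fun v hv => ((hk v hv).differentiableAt_coordAway
        (ne_of_mem_of_not_mem (hkK v hv) ha)).differentiableWithinAt) (fun v hv => ?_) hwr
    have h1 := Metric.mem_closedBall.1 (hmem hv)
    have h2 := Metric.mem_closedBall.1 (hmem hc)
    have h3 := dist_triangle_right (coordAway a (k v)) (coordAway a (k c)) 0
    have h4 := le_abs_self M
    exact Metric.mem_closedBall.2 (by linarith)
  have hlt : dist (coordAway a (k c)) (coordAway a (k w)) < δ := by
    rw [dist_comm]
    refine hdist.trans_lt ?_
    rw [lt_div_iff₀ (by positivity)] at hws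
    rw [div_mul_eq_mul_div, div_lt_iff₀ hr]
    nlinarith [dist_nonneg (x := w) (y := c)]
  have hmemV := @hδV (coordAway a (k c), coordAway a (k w)) ⟨hlt, hmem hc, hmem hwr⟩
  change (coordAwaySymm a (coordAway a (k c)), coordAwaySymm a (coordAway a (k w))) ∈ V at hmemV
  rwa [coordAwaySymm_coordAway (ne_of_mem_of_not_mem (hkK c hc) ha),
    coordAwaySymm_coordAway (ne_of_mem_of_not_mem (hkK w hwr) ha)] at hmemV

/-- A locally uniform limit of meromorphic functions with values in a fixed closed proper subset of
the sphere is meromorphic or locally constantly `∞` at each point. -/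
theorem isMeromorphicAtFinite_or_eventually_eq_infty_of_tendsto {p : Filter ℕ} [NeBot p]
    {U : Set ℂ} (hU : IsOpen U) {K : Set RiemannSphere} (hK : IsClosed K) {a : RiemannSphere}
    (ha : a ∉ K) {u : ℕ → ℂ → RiemannSphere} {g : ℂ → RiemannSphere}
    (hu : ∀ᶠ n in p, ∀ w ∈ U, IsMeromorphicAtFinite (u n) w) (huK : ∀ᶠ n in p, Set.MapsTo (u n) U K)
    (hlim : TendstoLocallyUniformlyOn u g p U) {w : ℂ} (hw : w ∈ U) :
    IsMeromorphicAtFinite g w ∨ ∀ᶠ v in 𝓝 w, g v = OnePoint.infty := by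
  have hgK : Set.MapsTo g U K := fun v hv =>
    hK.mem_of_tendsto (hlim.tendsto_at hv) (huK.mono fun n hn => hn hv)
  -- The coordinate is uniformly continuous on the compact set `K`, so it preserves locally uniform
  -- convergence and the Weierstrass theorem applies to the holomorphic compositions.
  have hlim' := (hK.isCompact.uniformContinuousOn_of_continuous
    (continuousOn_coordAway ha)).comp_tendstoLocallyUniformlyOn hlim hgK huK
  have hG : DifferentiableOn ℂ (coordAway a ∘ g) U := by
    refine hlim'.differentiableOn ?_ hU
    filter_upwards [hu, huK] with n hn hnK v hv
    exact ((hn v hv).differentiableAt_coordAway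
      (ne_of_mem_of_not_mem (hnK hv) ha)).differentiableWithinAt
  have heq : (fun v => coordAwaySymm a ((coordAway a ∘ g) v)) =ᶠ[𝓝 w] g := by
    filter_upwards [hU.mem_nhds hw] with v hv
    exact coordAwaySymm_coordAway (ne_of_mem_of_not_mem (hgK hv) ha)
  refine (isMeromorphicAtFinite_coordAwaySymm (hG.analyticAt (hU.mem_nhds hw)) a).imp
    (fun h => h.congr heq) fun h => ?_
  filter_upwards [h, heq] with v hv hve
  rwa [← hve]

/-! ### From the far-or-near condition to normality. -/

theorem tendsto_sphericalDist {α : Type*} {l : Filter α} {f g : α → RiemannSphere}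
    {a b : RiemannSphere} (hf : Tendsto f l (𝓝 a)) (hg : Tendsto g l (𝓝 b)) :
    Tendsto (fun x => sphericalDist (f x) (g x)) l (𝓝 (sphericalDist a b)) := by
  have hcomp := (continuous_sphericalDist.tendsto (a, b)).comp (hf.prodMk_nhds hg)
  exact hcomp

/-- Locally, the members of a family staying far from or near to `h` map into one of two fixed
closed proper subsets of the sphere. -/
theorem FarOrNearAt.exists_isClosed {F : Set (RiemannSphere → RiemannSphere)}
    {h : RiemannSphere → RiemannSphere} {D : Set RiemannSphere} {ε₁ ε₂ : ℝ} {z₀ : RiemannSphere}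
    (hP : FarOrNearAt F h D ε₁ ε₂ z₀) (hh : ContinuousAt h z₀) (h₁ : 0 < ε₁) (h₂ : ε₂ < Real.pi) :
    ∃ r, 0 < r ∧ disc z₀ r ⊆ D ∧ ∃ K₁ K₂ : Set RiemannSphere, ∃ a₁ a₂ : RiemannSphere,
      IsClosed K₁ ∧ IsClosed K₂ ∧ a₁ ∉ K₁ ∧ a₂ ∉ K₂ ∧
        ∀ f ∈ F, Set.MapsTo f (disc z₀ r) K₁ ∨ Set.MapsTo f (disc z₀ r) K₂ := by
  obtain ⟨r, hr, hrD, hF⟩ := hP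
  obtain ⟨b, hb⟩ := exists_sphericalDist_eq_pi (h z₀)
  -- Replacing `h z` by `h z₀` costs less than this margin: far members stay at least `ε₁ / 2` from
  -- `h z₀`, and near ones within `(π + ε₂) / 2 < π` of it, hence away from its antipode `b`.
  have hδ : 0 < min (ε₁ / 2) ((Real.pi - ε₂) / 2) := lt_min (by linarith) (by linarith)
  have hdist (c : RiemannSphere) : Continuous fun z => sphericalDist z c :=
    continuous_iff_continuousAt.2 fun _ => tendsto_sphericalDist tendsto_id tendsto_const_nhds
  have hnear : ∀ᶠ z in 𝓝 z₀, sphericalDist (h z) (h z₀) < min (ε₁ / 2) ((Real.pi - ε₂) / 2) := by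
    have ht := tendsto_sphericalDist hh.tendsto (tendsto_const_nhds (x := h z₀))
    rw [sphericalDist_self] at ht
    exact ht.eventually (gt_mem_nhds hδ)
  obtain ⟨s, hs, hsub⟩ := (hasBasis_nhds_disc z₀).eventually_iff.1 hnear
  have hr' := disc_subset_disc z₀ (min_le_left r s)
  have hs' := disc_subset_disc z₀ (min_le_right r s)
  refine ⟨min r s, lt_min hr hs, hr'.trans hrD,
    {z | ε₁ / 2 ≤ sphericalDist z (h z₀)}, {z | sphericalDist z (h z₀) ≤ (Real.pi + ε₂) / 2},
    h z₀, b, isClosed_le continuous_const (hdist _), isClosed_le (hdist _) continuous_const,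
    ?_, ?_, fun f hf => (hF f hf).imp (fun H z hz => ?_) fun H z hz => ?_⟩
  · change ¬ε₁ / 2 ≤ sphericalDist (h z₀) (h z₀)
    rw [sphericalDist_self]
    linarith
  · change ¬sphericalDist b (h z₀) ≤ (Real.pi + ε₂) / 2
    rw [hb]
    linarith
  · have h3 := lt_min_iff.1 (hsub (hs' hz))
    have h4 := H z (hr' hz)
    have h5 := sphericalDist_triangle (f z) (h z₀) (h z)
    rw [sphericalDist_comm (h z₀)] at h5
    change ε₁ / 2 ≤ sphericalDist (f z) (h z₀)
    linarith
  · have h3 := lt_min_iff.1 (hsub (hs' hz))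
    have h4 := H z (hr' hz)
    have h5 := sphericalDist_triangle (f z) (h z) (h z₀)
    change sphericalDist (f z) (h z₀) ≤ (Real.pi + ε₂) / 2
    linarith

theorem disc_mem_nhds {z₀ : RiemannSphere} {r : ℝ} (hr : 0 < r) : disc z₀ r ∈ 𝓝 z₀ :=
  (hasBasis_nhds_disc z₀).mem_of_mem hr

theorem eventually_chart_iff {z₀ : RiemannSphere} {q : RiemannSphere → Prop} :
    (∀ᶠ w in 𝓝 (chartCenter z₀), q (chart z₀ w)) ↔ ∀ᶠ z in 𝓝 z₀, q z := by
  have h := (isOpenEmbedding_chart z₀).map_nhds_eq (chartCenter z₀)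
  rw [chart_chartCenter] at h
  rw [← h, eventually_map]

theorem IsMeromorphicAt.eventually_ne_infty {f : RiemannSphere → RiemannSphere}
    {z₀ : RiemannSphere} (hf : IsMeromorphicAt f z₀) :
    ∀ᶠ z in 𝓝[≠] z₀, f z ≠ OnePoint.infty := by
  have h1 := eventually_nhdsWithin_iff.1 (isMeromorphicAt_iff.1 hf).1
  rw [eventually_nhdsWithin_iff, ← eventually_chart_iff]
  filter_upwards [h1] with w hw hne
  exact hw fun hwc => hne (by rw [hwc]; exact chart_chartCenter z₀)

/-- A function on a connected set that at each point is meromorphic or locally constantly `∞` is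
globally meromorphic or constantly `∞`. -/
theorem isMeromorphicOn_or_eq_infty {D : Set RiemannSphere} (hD : IsPreconnected D)
    {g : RiemannSphere → RiemannSphere}
    (hg : ∀ z ∈ D, IsMeromorphicAt g z ∨ ∀ᶠ w in 𝓝 z, g w = OnePoint.infty) :
    IsMeromorphicOn g D ∨ ∀ z ∈ D, g z = OnePoint.infty := by
  have hUo : IsOpen {z | ∀ᶠ w in 𝓝 z, g w = OnePoint.infty} := isOpen_setOfPred_eventually_nhds
  have hVo : IsOpen {z | ∀ᶠ w in 𝓝[≠] z, g w ≠ OnePoint.infty} := by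
    rw [isOpen_iff_mem_nhds]
    intro z hz
    have h1 := eventually_nhdsWithin_iff.1 hz
    filter_upwards [eventually_eventually_nhds.2 h1] with y hy
    rcases eq_or_ne y z with rfl | hyz
    · exact hz
    · refine Eventually.filter_mono nhdsWithin_le_nhds ?_
      filter_upwards [hy, isOpen_compl_singleton.mem_nhds hyz] with x hx hxz
      exact hx hxz
  -- The sphere has no isolated points, so punctured neighbourhoods are never trivial and the two
  -- open sets are disjoint.
  have hdisj (z : RiemannSphere) (hU : ∀ᶠ w in 𝓝 z, g w = OnePoint.infty)
      (hV : ∀ᶠ w in 𝓝[≠] z, g w ≠ OnePoint.infty) : False := by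
    obtain ⟨w, hw1, hw2⟩ := ((hU.filter_mono nhdsWithin_le_nhds).and hV).exists
    exact hw2 hw1
  by_cases hU : (D ∩ {z | ∀ᶠ w in 𝓝 z, g w = OnePoint.infty}).Nonempty
  · right
    intro z hz
    rcases hg z hz with hm | hi
    · obtain ⟨y, -, hyU, hyV⟩ := hD _ _ hUo hVo
        (fun z hz => (hg z hz).symm.imp id IsMeromorphicAt.eventually_ne_infty) hU
        ⟨z, hz, hm.eventually_ne_infty⟩
      exact (hdisj y hyU hyV).elim
    · exact hi.self_of_nhds
  · left
    intro z hz
    exact (hg z hz).resolve_right fun hi => hU ⟨z, hz, hi⟩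

theorem IsMeromorphicOn.continuousOn {f : RiemannSphere → RiemannSphere} {D : Set RiemannSphere}
    (hf : IsMeromorphicOn f D) : ContinuousOn f D := fun z hz =>
  (hf z hz).continuousAt.continuousWithinAt

/-- A family of meromorphic functions on a domain that locally map into one of two closed proper
subsets of the sphere is normal. -/
theorem isNormalFamily_of_mapsTo {D : Set RiemannSphere} (hDo : IsOpen D) (hDc : IsPreconnected D)
    {F : Set (RiemannSphere → RiemannSphere)} (hF : ∀ f ∈ F, IsMeromorphicOn f D)
    (hloc : ∀ z₀ ∈ D, ∃ r, 0 < r ∧ disc z₀ r ⊆ D ∧ ∃ K₁ K₂ : Set RiemannSphere,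
      ∃ a₁ a₂ : RiemannSphere, IsClosed K₁ ∧ IsClosed K₂ ∧ a₁ ∉ K₁ ∧ a₂ ∉ K₂ ∧
        ∀ f ∈ F, Set.MapsTo f (disc z₀ r) K₁ ∨ Set.MapsTo f (disc z₀ r) K₂) :
    IsNormalFamily F D := by
  have hmer {z₀ : RiemannSphere} {r : ℝ} (hrD : disc z₀ r ⊆ D) {f : RiemannSphere → RiemannSphere}
      (hf : f ∈ F) (w : ℂ) (hw : w ∈ Metric.ball (chartCenter z₀) r) :
      IsMeromorphicAtFinite (fun v => f (chart z₀ v)) w := by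
    refine (hF f hf _ (hrD ?_)).comp_chart
    rw [disc_eq_image_chart]
    exact Set.mem_image_of_mem _ hw
  have hmem {z₀ : RiemannSphere} {r : ℝ} {w : ℂ} (hw : w ∈ Metric.ball (chartCenter z₀) r) :
      chart z₀ w ∈ disc z₀ r := by
    rw [disc_eq_image_chart]
    exact Set.mem_image_of_mem _ hw
  intro u hu
  let φ (n : ℕ) : C(D, RiemannSphere) :=
    ⟨fun x => u n x, (hF _ (hu n)).continuousOn.domRestrict⟩
  have heq : (ContinuousMap.toFun '' Set.range φ).Equicontinuous := by
    rintro ⟨z₀, hz₀⟩ V hV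
    obtain ⟨r, hr, hrD, K₁, K₂, a₁, a₂, hK₁, hK₂, ha₁, ha₂, hFK⟩ := hloc z₀ hz₀
    obtain ⟨s₁, hs₁, H₁⟩ := exists_ball_forall_mem_uniformity hK₁ ha₁ (chartCenter z₀) hr hV
    obtain ⟨s₂, hs₂, H₂⟩ := exists_ball_forall_mem_uniformity hK₂ ha₂ (chartCenter z₀) hr hV
    have hnhds : ∀ᶠ x : D in 𝓝 ⟨z₀, hz₀⟩, (x : RiemannSphere) ∈ disc z₀ (min s₁ s₂) :=
      continuous_subtype_val.continuousAt.eventually (disc_mem_nhds (lt_min hs₁ hs₂))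
    filter_upwards [hnhds] with x hx
    rintro ⟨_, _, ⟨n, rfl⟩, rfl⟩
    rw [disc_eq_image_chart] at hx
    obtain ⟨w, hw, hwx⟩ := hx
    change (u n z₀, u n x) ∈ V
    rw [← hwx]
    have hc : u n z₀ = u n (chart z₀ (chartCenter z₀)) := by rw [chart_chartCenter]
    rw [hc]
    rcases hFK _ (hu n) with hn | hn
    · exact H₁ _ (hmer hrD (hu n)) (fun v hv => hn (hmem hv)) w
        (Metric.ball_subset_ball (min_le_left _ _) hw)
    · exact H₂ _ (hmer hrD (hu n)) (fun v hv => hn (hmem hv)) w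
        (Metric.ball_subset_ball (min_le_right _ _) hw)
  obtain ⟨S, hS, hsub⟩ := exists_isCompact_superset_of_equicontinuous _ heq
  have : LocallyCompactSpace D := hDo.locallyCompactSpace
  obtain ⟨ψ, -, k, hk, hlim⟩ := hS.isSeqCompact fun n => hsub ⟨n, rfl⟩
  classical
  -- The value off `D` is arbitrary: only points of the open set `D` matter.
  let g : RiemannSphere → RiemannSphere := fun z =>
    if hz : z ∈ D then ψ ⟨z, hz⟩ else OnePoint.infty
  have hgψ : g ∘ ((↑) : D → RiemannSphere) = ψ := by
    ext x
    exact dif_pos x.2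
  have hconv : TendstoLocallyUniformlyOn (fun n => u (k n)) g atTop D := by
    rw [tendstoLocallyUniformlyOn_iff_tendstoLocallyUniformly_comp_coe, hgψ]
    exact ContinuousMap.tendsto_iff_tendstoLocallyUniformly.1 hlim
  refine ⟨k, hk, g, isMeromorphicOn_or_eq_infty hDc fun z₀ hz₀ => ?_, tendstoLocUnif_iff.2 hconv⟩
  obtain ⟨r, hr, hrD, K₁, K₂, a₁, a₂, hK₁, hK₂, ha₁, ha₂, hFK⟩ := hloc z₀ hz₀
  have key {K : Set RiemannSphere} (hK : IsClosed K) {a : RiemannSphere} (ha : a ∉ K)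
      (hfr : ∃ᶠ n in atTop, Set.MapsTo (u (k n)) (disc z₀ r) K) :
      IsMeromorphicAt g z₀ ∨ ∀ᶠ w in 𝓝 z₀, g w = OnePoint.infty := by
    -- Restricting to the indices whose terms map into `K` leaves a proper filter, along which the
    -- limit is still `g`.
    have hne : NeBot (atTop ⊓ 𝓟 {n | Set.MapsTo (u (k n)) (disc z₀ r) K}) :=
      frequently_mem_iff_neBot.1 hfr
    have hconv' : TendstoLocallyUniformlyOn (fun n => u (k n) ∘ chart z₀) (g ∘ chart z₀)
        (atTop ⊓ 𝓟 {n | Set.MapsTo (u (k n)) (disc z₀ r) K})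
        (Metric.ball (chartCenter z₀) r) := by
      have h1 := hconv.comp (chart z₀) (fun w hw => hrD (hmem hw))
        (isOpenEmbedding_chart z₀).continuous.continuousOn
      intro V hV w hw
      obtain ⟨t, ht, hn⟩ := h1 V hV w hw
      exact ⟨t, ht, hn.filter_mono inf_le_left⟩
    have hmaps : ∀ᶠ n in atTop ⊓ 𝓟 {n | Set.MapsTo (u (k n)) (disc z₀ r) K},
        Set.MapsTo (u (k n) ∘ chart z₀) (Metric.ball (chartCenter z₀) r) K := by
      filter_upwards [mem_inf_of_right (mem_principal_self _)] with n hn w hw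
      exact hn (hmem hw)
    have h2 := isMeromorphicAtFinite_or_eventually_eq_infty_of_tendsto Metric.isOpen_ball hK ha
      (Eventually.of_forall fun n => hmer hrD (hu (k n)))
      hmaps hconv'
      (Metric.mem_ball_self hr)
    exact h2.imp isMeromorphicAt_iff.2 eventually_chart_iff.1
  -- Pigeonhole: the choice between `K₁` and `K₂` may vary with `n`, but one of them occurs
  -- infinitely often.
  have hfr : ∃ᶠ n in atTop, Set.MapsTo (u (k n)) (disc z₀ r) K₁ ∨
      Set.MapsTo (u (k n)) (disc z₀ r) K₂ :=
    Frequently.of_forall fun n => hFK _ (hu (k n))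
  exact (frequently_or_distrib.1 hfr).elim (key hK₁ ha₁) (key hK₂ ha₂)

/-! ### From normality to the far-or-near condition. -/

theorem IsNormalFamily.farOrNearAt {F : Set (RiemannSphere → RiemannSphere)}
    {D : Set RiemannSphere} (hN : IsNormalFamily F D) (hDo : IsOpen D)
    {h : RiemannSphere → RiemannSphere} {z₀ : RiemannSphere} (hz₀ : z₀ ∈ D)
    (hh : ContinuousAt h z₀) {ε₁ ε₂ : ℝ} (hε : ε₁ < ε₂) : FarOrNearAt F h D ε₁ ε₂ z₀ := by
  by_contra hcon
  obtain ⟨r₀, hr₀, hr₀D⟩ := (hasBasis_nhds_disc z₀).mem_iff.1 (hDo.mem_nhds hz₀)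
  have hr (n : ℕ) : 0 < r₀ / (n + 1) := by positivity
  have hrle (n : ℕ) : r₀ / (n + 1) ≤ r₀ :=
    div_le_self hr₀.le (by linarith [n.cast_nonneg (α := ℝ)])
  -- Failure on every small disc yields one function that is both close to `h` at some point and far
  -- from it at another.
  have hbad (n : ℕ) : ∃ f ∈ F, ∃ z ∈ disc z₀ (r₀ / (n + 1)), ∃ w ∈ disc z₀ (r₀ / (n + 1)),
      sphericalDist (f z) (h z) ≤ ε₁ ∧ ε₂ ≤ sphericalDist (f w) (h w) := by
    by_contra hnot
    push Not at hnot
    refine hcon ⟨_, hr n, (disc_subset_disc z₀ (hrle n)).trans hr₀D, fun f hf => ?_⟩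
    by_contra hfn
    push Not at hfn
    obtain ⟨⟨z, hz, hfz⟩, w, hw, hfw⟩ := hfn
    exact absurd hfw (not_le.2 (hnot f hf z hz w hw hfz))
  choose f hf z hz w hw hzε hwε using hbad
  obtain ⟨k, hk, g, hg, hconv⟩ := hN f hf
  rw [tendstoLocUnif_iff] at hconv
  have hgc : ContinuousAt g z₀ := by
    rcases hg with hg | hg
    · exact (hg z₀ hz₀).continuousAt
    · refine (continuousAt_const (y := (OnePoint.infty : RiemannSphere))).congr ?_
      filter_upwards [hDo.mem_nhds hz₀] with x hx
      exact (hg x hx).symm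
  -- Locally uniform convergence to a limit continuous at `z₀` allows evaluation at moving points,
  -- so the limit does not depend on `y`; taking `y = z` and `y = w` gives the contradiction.
  have hdist {y : ℕ → RiemannSphere} (hy : ∀ n : ℕ, y n ∈ disc z₀ (r₀ / (n + 1))) :
      Tendsto (fun n => sphericalDist (f (k n) (y (k n))) (h (y (k n)))) atTop
        (𝓝 (sphericalDist (g z₀) (h z₀))) := by
    have hy0 : Tendsto y atTop (𝓝 z₀) := by
      rw [(hasBasis_nhds_disc z₀).tendsto_right_iff]
      intro s hs
      have h0 : Tendsto (fun n : ℕ => r₀ / ((n : ℝ) + 1)) atTop (𝓝 0) :=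
        tendsto_const_nhds.div_atTop (tendsto_atTop_add_const_right _ _ tendsto_natCast_atTop_atTop)
      filter_upwards [h0.eventually (gt_mem_nhds hs)] with n hn
      exact disc_subset_disc z₀ hn.le (hy n)
    have hyk : Tendsto (fun n => y (k n)) atTop (𝓝 z₀) := hy0.comp hk.tendsto_atTop
    have hyD : Tendsto (fun n => y (k n)) atTop (𝓝[D] z₀) :=
      tendsto_nhdsWithin_iff.2 ⟨hyk, Eventually.of_forall fun n =>
        hr₀D (disc_subset_disc z₀ (hrle (k n)) (hy (k n)))⟩
    exact tendsto_sphericalDist (hconv.tendsto_comp hgc.continuousWithinAt hz₀ hyD)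
      (hh.tendsto.comp hyk)
  have h1 := le_of_tendsto (hdist hz) (Eventually.of_forall fun n => hzε (k n))
  have h2 := ge_of_tendsto (hdist hw) (Eventually.of_forall fun n => hwε (k n))
  linarith

end RiemannSphere

end

theorem theorem1p4 (D : Set RiemannSphere) (hDo : IsOpen D) (hDc : IsConnected D)
    (F : Set (RiemannSphere → RiemannSphere))
    (hF : ∀ f ∈ F, RiemannSphere.IsMeromorphicOn f D)
    (h : RiemannSphere → RiemannSphere) (hh : RiemannSphere.IsMeromorphicOn h D) :
    (∀ ε₁ ε₂ : ℝ, 0 < ε₁ → ε₁ < ε₂ → ε₂ < Real.pi →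
      (RiemannSphere.IsNormalFamily F D ↔
        ∀ z₀ ∈ D, RiemannSphere.FarOrNearAt F h D ε₁ ε₂ z₀)) ∧
    (RiemannSphere.IsNormalFamily F D ↔
      ∀ z₀ ∈ D, ∃ ε₁ ε₂ : ℝ, 0 < ε₁ ∧ ε₁ < ε₂ ∧ ε₂ < Real.pi ∧
        RiemannSphere.FarOrNearAt F h D ε₁ ε₂ z₀) := by
  have hnormal (H : ∀ z₀ ∈ D, ∃ ε₁ ε₂ : ℝ, 0 < ε₁ ∧ ε₁ < ε₂ ∧ ε₂ < Real.pi ∧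
      RiemannSphere.FarOrNearAt F h D ε₁ ε₂ z₀) : RiemannSphere.IsNormalFamily F D := by
    refine RiemannSphere.isNormalFamily_of_mapsTo hDo hDc.isPreconnected hF fun z₀ hz₀ => ?_
    obtain ⟨ε₁, ε₂, h₁, -, h₂, hP⟩ := H z₀ hz₀
    exact hP.exists_isClosed (hh z₀ hz₀).continuousAt h₁ h₂
  -- In the second equivalence a normal family admits any pair; `1 < 2 < π` is a convenient one.
  refine ⟨fun ε₁ ε₂ h₁ h₁₂ h₂ => ⟨fun hN z₀ hz₀ => ?_, fun H => hnormal fun z₀ hz₀ => ?_⟩,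
    fun hN z₀ hz₀ => ⟨1, 2, one_pos, one_lt_two, ?_, ?_⟩, hnormal⟩
  · exact hN.farOrNearAt hDo hz₀ (hh z₀ hz₀).continuousAt h₁₂
  · exact ⟨ε₁, ε₂, h₁, h₁₂, h₂, H z₀ hz₀⟩
  · linarith [Real.pi_gt_three]
  · exact hN.farOrNearAt hDo hz₀ (hh z₀ hz₀).continuousAt one_lt_two
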